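/- Let $-\infty\le a<b\le\infty$, let $\mathcal{HK}$ be the set of real-valued functions on $(a,b)$ that are Henstock--Kurzweil integrable over $(a,b)$, and for $h\in\mathcal{HK}$ let $\|h\|=\sup_I\left|\int_I h\right|$, the supremum being over all intervals $I\subset(a,b)$ (the Alexiewicz norm). Let $g$ and $g_n$ ($n\ge 1$) be real-valued functions on $(a,b)$. Then the following two statements are equivalent: (i) for every $f\in\mathcal{HK}$, the products $fg$ and $fg_n$ ($n\ge1$) belong to $\mathcal{HK}$ and $\int_a^b fg_n\to\int_a^b fg$ as $n\to\infty$; (ii) for every $f\in\mathcal{HK}$, the products $fg$ and $fg_n$ ($n\ge1$) belong to $\mathcal{HK}$ and $\|fg_n-fg\|\to 0$ as $n\to\infty$. -/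

import Mathlib

open Filter Topology
open scoped ENNReal

namespace HenstockKurzweil

/-- A tagged partition of the compact interval `[a, b]` of the extended real line: division points
`a = pt 0 ≤ pt 1 ≤ ⋯ ≤ pt n = b` and tags `tag i ∈ [pt i, pt (i + 1)]` for `i < n`. -/
structure TaggedPartition (a b : EReal) where
  /-- the number of subintervals -/
  n : ℕ
  /-- the division points (only `pt 0, …, pt n` are relevant) -/
  pt : ℕ → EReal
  /-- the tags (only `tag 0, …, tag (n - 1)` are relevant) -/
  tag : ℕ → EReal
  pt_zero : pt 0 = a
  pt_last : pt n = b
  tag_mem : ∀ i < n, tag i ∈ Set.Icc (pt i) (pt (i + 1))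

/-- A gauge on the extended real line: a neighbourhood of every point, those of the finite points
being required not to contain the points at infinity. -/
def IsGauge (U : EReal → Set EReal) : Prop :=
  (∀ t, U t ∈ 𝓝 t) ∧ ∀ x : ℝ, ⊥ ∉ U (x : EReal) ∧ ⊤ ∉ U (x : EReal)

/-- `P` is `U`-fine: each subinterval lies in the neighbourhood that the gauge attaches to its
tag. -/
def TaggedPartition.IsFine {a b : EReal} (P : TaggedPartition a b) (U : EReal → Set EReal) : Prop :=
  ∀ i < P.n, Set.Icc (P.pt i) (P.pt (i + 1)) ⊆ U (P.tag i)

open Classical in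
/-- A function on `(a, b)`, extended by `0` to the extended real line. -/
noncomputable def extendZero (f : ℝ → ℝ) (a b : EReal) (t : EReal) : ℝ :=
  if t ∈ Set.Ioo a b then f t.toReal else 0

/-- The Riemann sum of `f` over a tagged partition of `[a, b]`. The integrand is `0` at `a` and `b`,
whence the convention `0 · ∞ = 0` for an unbounded subinterval whose tag is infinite;
an unbounded subinterval with a finite tag does not occur in a partition that is fine
for a gauge. -/
noncomputable def TaggedPartition.riemannSum {a b : EReal} (P : TaggedPartition a b)
    (f : ℝ → ℝ) : ℝ :=
  ∑ i ∈ Finset.range P.n,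
    extendZero f a b (P.tag i) * ((P.pt (i + 1)).toReal - (P.pt i).toReal)

/-- `f` has the Henstock–Kurzweil integral `A` over `(a, b)`, where `-∞ ≤ a ≤ b ≤ ∞`. -/
def HasIntegral (f : ℝ → ℝ) (a b : EReal) (A : ℝ) : Prop :=
  ∀ ε > 0, ∃ U, IsGauge U ∧
    ∀ P : TaggedPartition a b, P.IsFine U → |P.riemannSum f - A| < ε

/-- `f` is Henstock–Kurzweil integrable over `(a, b)`. -/
def Integrable (f : ℝ → ℝ) (a b : EReal) : Prop :=
  ∃ A, HasIntegral f a b A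

open Classical in
/-- The Henstock–Kurzweil integral of `f` over `(a, b)` (`0` if `f` is not integrable). -/
noncomputable def integral (f : ℝ → ℝ) (a b : EReal) : ℝ :=
  if h : Integrable f a b then h.choose else 0

/-- The Alexiewicz norm of a Henstock–Kurzweil integrable function `f` on `(a, b)`: the supremum
of `|∫_c^d f|` over all intervals with end points `a ≤ c ≤ d ≤ b`, as an extended nonnegative
real. -/
noncomputable def alexiewiczNorm (f : ℝ → ℝ) (a b : EReal) : ℝ≥0∞ :=
  ⨆ (c : EReal) (d : EReal) (_ : a ≤ c ∧ c ≤ d ∧ d ≤ b), ENNReal.ofReal |integral f c d|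

end HenstockKurzweil

namespace HenstockKurzweil

/-! (ii) gives (i) because (a, b) itself competes in the supremum defining the norm. For the
converse put `h n = gn n - g`, so that the integrals of `f * h n` tend to 0 for every integrable
`f`, and let `G n` be a primitive of `f * h n`. Testing with `f` times the indicator of (c, d) gives
`G n d - G n c → 0` for each pair; what is needed is uniformity in `c` and `d`
(`eventually_increments_le`).

If uniformity fails, compactness of the extended line yields points tending to some `x₀` whose
increments to `x₀` stay large along a subsequence of `G` (`exists_frequently_of_not_uniform`). A
gliding hump (`exists_gliding_hump`) thins this out: over the intervals between these points and
`x₀`, the increments of a primitive of `f` become summable, and the matrix of increments of the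
`G`'s gets a dominant diagonal. Then `f` times the sum of the indicators of these intervals is
integrable (`IsPrimitive.tsum_indicator`), but its integrals against the selected `h n` are row sums
of that matrix, bounded away from 0 (`abs_tsum_ge`), a contradiction. The intervals share the end
point `x₀` and may overlap; only summability of the increments matters.

The integration theory rests on `NullOn`. A primitive `F` of `φ` is one for which `φ t * (v - u) -
(F v - F u)` has variation zero. This condition is local (`NullOn.congr_nhds`), countably additive
in the set of tags (`NullOn.iUnion`), and at a single tag follows from continuity
(`nullOn_singleton`), so primitives can be verified piecewise. The Saks–Henstock lemma
`exists_nullOn_sub` connects them with Riemann sums. -/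

/-! ### Tagged partitions: concatenation, Cousin's lemma, refinement -/

/-- The sum over a tagged partition of a function of a tag and of the two end points. -/
noncomputable def TaggedPartition.sum {a b : EReal} (P : TaggedPartition a b)
    (h : EReal → EReal → EReal → ℝ) : ℝ :=
  ∑ i ∈ Finset.range P.n, h (P.tag i) (P.pt i) (P.pt (i + 1))

/-- Removing the infinite points from a neighbourhood of a finite point leaves a neighbourhood, so
that gauges can be specified by neighbourhoods alone. -/
theorem exists_gauge_subset (V : EReal → Set EReal) (hV : ∀ t, V t ∈ 𝓝 t) :
    ∃ U, IsGauge U ∧ ∀ t, U t ⊆ V t := by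
  refine ⟨fun t => V t ∩ {y | t ≠ ⊥ → t ≠ ⊤ → y ≠ ⊥ ∧ y ≠ ⊤}, ⟨fun t => ?_, fun x => ?_⟩,
    fun t => Set.inter_subset_left⟩
  · refine inter_mem (hV t) ?_
    by_cases h1 : t = ⊥
    · simp [h1]
    by_cases h2 : t = ⊤
    · simp [h2]
    filter_upwards [isOpen_ne.mem_nhds h1, isOpen_ne.mem_nhds h2] with y hy1 hy2 _ _
    exact ⟨hy1, hy2⟩
  · simp

theorem IsGauge.inter {U V : EReal → Set EReal} (hU : IsGauge U) (hV : IsGauge V) :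
    IsGauge (fun t => U t ∩ V t) :=
  ⟨fun t => inter_mem (hU.1 t) (hV.1 t), fun x =>
    ⟨fun h => (hU.2 x).1 h.1, fun h => (hU.2 x).2 h.1⟩⟩

namespace TaggedPartition

variable {a b c : EReal}

theorem IsFine.mono {P : TaggedPartition a b} {U V : EReal → Set EReal} (hP : P.IsFine U)
    (h : ∀ t, U t ⊆ V t) : P.IsFine V :=
  fun i hi => (hP i hi).trans (h _)

theorem pt_le_succ (P : TaggedPartition a b) {i : ℕ} (hi : i < P.n) : P.pt i ≤ P.pt (i + 1) :=
  (P.tag_mem i hi).1.trans (P.tag_mem i hi).2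

theorem pt_mono (P : TaggedPartition a b) {i j : ℕ} (hij : i ≤ j) (hj : j ≤ P.n) :
    P.pt i ≤ P.pt j := by
  induction j, hij using Nat.le_induction with
  | base => exact le_rfl
  | succ k hk ih => exact (ih (by omega)).trans (P.pt_le_succ (by omega))

/-- The concatenation of two tagged partitions. -/
def append (P : TaggedPartition a b) (Q : TaggedPartition b c) : TaggedPartition a c where
  n := P.n + Q.n
  pt i := if i < P.n then P.pt i else Q.pt (i - P.n)
  tag i := if i < P.n then P.tag i else Q.tag (i - P.n)
  pt_zero := by
    split_ifs with h
    · exact P.pt_zero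
    · have h0 : P.n = 0 := by omega
      have := P.pt_last
      rw [h0, P.pt_zero] at this
      simp [Q.pt_zero, this]
  pt_last := by simp [Q.pt_last]
  tag_mem i hi := by
    by_cases h : i < P.n
    · have := P.tag_mem i h
      by_cases h1 : i + 1 < P.n
      · simpa [h, h1] using this
      · have h2 : i + 1 = P.n := by omega
        rw [h2, P.pt_last] at this
        simpa [h, h2, Q.pt_zero] using this
    · have := Q.tag_mem (i - P.n) (by omega)
      have h1 : ¬ i + 1 < P.n := by omega
      rw [show i - P.n + 1 = i + 1 - P.n by omega] at this
      simpa [h, h1] using this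

theorem append_left (P : TaggedPartition a b) (Q : TaggedPartition b c) {i : ℕ} (hi : i < P.n) :
    (P.append Q).tag i = P.tag i ∧ (P.append Q).pt i = P.pt i ∧
      (P.append Q).pt (i + 1) = P.pt (i + 1) := by
  refine ⟨if_pos hi, if_pos hi, ?_⟩
  by_cases h1 : i + 1 < P.n
  · exact if_pos h1
  · have h2 : i + 1 = P.n := by omega
    simp [append, h2, P.pt_last, Q.pt_zero]

theorem append_right (P : TaggedPartition a b) (Q : TaggedPartition b c) (i : ℕ) :
    (P.append Q).tag (P.n + i) = Q.tag i ∧ (P.append Q).pt (P.n + i) = Q.pt i ∧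
      (P.append Q).pt (P.n + i + 1) = Q.pt (i + 1) := by
  refine ⟨?_, ?_, ?_⟩ <;> simp [append, add_assoc]

theorem sum_append (P : TaggedPartition a b) (Q : TaggedPartition b c)
    (h : EReal → EReal → EReal → ℝ) : (P.append Q).sum h = P.sum h + Q.sum h := by
  unfold sum
  rw [show (P.append Q).n = P.n + Q.n from rfl, Finset.sum_range_add]
  congr 1
  · refine Finset.sum_congr rfl fun i hi => ?_
    obtain ⟨h1, h2, h3⟩ := P.append_left Q (Finset.mem_range.1 hi)
    rw [h1, h2, h3]
  · refine Finset.sum_congr rfl fun i _ => ?_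
    obtain ⟨h1, h2, h3⟩ := P.append_right Q i
    rw [h1, h2, h3]

theorem IsFine.append {P : TaggedPartition a b} {Q : TaggedPartition b c}
    {U : EReal → Set EReal} (hP : P.IsFine U) (hQ : Q.IsFine U) : (P.append Q).IsFine U := by
  intro i hi
  by_cases h : i < P.n
  · obtain ⟨h1, h2, h3⟩ := P.append_left Q h
    rw [h1, h2, h3]
    exact hP i h
  · obtain ⟨j, rfl⟩ := Nat.exists_eq_add_of_le (not_lt.1 h)
    obtain ⟨h1, h2, h3⟩ := P.append_right Q j
    rw [h1, h2, h3]
    exact hQ j (Nat.add_lt_add_iff_left.1 hi)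

/-- The partition without subintervals of a degenerate interval. -/
def nil (a : EReal) : TaggedPartition a a where
  n := 0
  pt _ := a
  tag _ := a
  pt_zero := rfl
  pt_last := rfl
  tag_mem i hi := absurd hi (Nat.not_lt_zero i)

theorem isFine_nil (a : EReal) (U : EReal → Set EReal) : (nil a).IsFine U :=
  fun i hi => absurd hi (Nat.not_lt_zero i)

theorem sum_nil (a : EReal) (h : EReal → EReal → EReal → ℝ) : (nil a).sum h = 0 := by
  simp [sum, nil]

/-- The partition of `[a, b]` into a single interval with tag `t`. -/
def single (a t b : EReal) (ha : a ≤ t) (hb : t ≤ b) : TaggedPartition a b where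
  n := 1
  pt i := if i = 0 then a else b
  tag _ := t
  pt_zero := rfl
  pt_last := rfl
  tag_mem i hi := by
    obtain rfl : i = 0 := by omega
    exact ⟨ha, hb⟩

theorem isFine_single {a t b : EReal} (ha : a ≤ t) (hb : t ≤ b) {U : EReal → Set EReal}
    (h : Set.Icc a b ⊆ U t) : (single a t b ha hb).IsFine U := by
  intro i hi
  obtain rfl : i = 0 := Nat.lt_one_iff.1 hi
  exact h

theorem sum_single {a t b : EReal} (ha : a ≤ t) (hb : t ≤ b)
    (h : EReal → EReal → EReal → ℝ) : (single a t b ha hb).sum h = h t a b := by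
  simp [sum, single]

/-- Cousin's lemma. -/
theorem exists_isFine {U : EReal → Set EReal} (hU : ∀ t, U t ∈ 𝓝 t) {a b : EReal} (hab : a ≤ b) :
    ∃ P : TaggedPartition a b, P.IsFine U := by
  -- The supremum of the reachable points is itself reachable, by one more cell tagged there; if it
  -- were below `b`, a further cell with the same tag would pass it.
  set S : Set EReal := {x | a ≤ x ∧ x ≤ b ∧ ∃ P : TaggedPartition a x, P.IsFine U} with hS
  have haS : a ∈ S := ⟨le_rfl, hab, nil a, isFine_nil a U⟩
  set x := sSup S with hx
  have hax : a ≤ x := le_sSup haS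
  have hxb : x ≤ b := sSup_le fun y hy => hy.2.1
  have hxS : x ∈ S := by
    rcases hax.eq_or_lt with h | h
    · rwa [← h]
    obtain ⟨l, hl, hlU⟩ := exists_Ioc_subset_of_mem_nhds (hU x) ⟨a, h⟩
    obtain ⟨s, hs, hls⟩ := lt_sSup_iff.1 hl
    have hsx : s ≤ x := le_sSup hs
    obtain ⟨-, -, P, hP⟩ := hs
    exact ⟨hax, hxb, P.append (single s x x hsx le_rfl), hP.append
      (isFine_single _ _ fun y hy => hlU ⟨hls.trans_le hy.1, hy.2⟩)⟩
  rcases hxb.eq_or_lt with h | h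
  · rw [← h]
    exact hxS.2.2
  obtain ⟨r, hr, hrU⟩ := exists_Ico_subset_of_mem_nhds (hU x) ⟨b, h⟩
  obtain ⟨y, hxy, hy⟩ := exists_between (lt_min hr h)
  obtain ⟨-, -, P, hP⟩ := hxS
  have : y ∈ S := ⟨hax.trans hxy.le, (hy.trans_le (min_le_right _ _)).le,
    P.append (single x x y le_rfl hxy.le), hP.append (isFine_single _ _ fun z hz =>
      hrU ⟨hz.1, hz.2.trans_lt (hy.trans_le (min_le_left _ _))⟩)⟩
  exact absurd (le_sSup this) (not_le.2 hxy)

theorem sum_telescope (P : TaggedPartition a b) (F : EReal → ℝ) :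
    P.sum (fun _ u v => F v - F u) = F b - F a := by
  rw [sum, Finset.sum_range_sub (fun i => F (P.pt i)), P.pt_zero, P.pt_last]

theorem sum_sub (P : TaggedPartition a b) (h k : EReal → EReal → EReal → ℝ) :
    P.sum (fun t u v => h t u v - k t u v) = P.sum h - P.sum k :=
  Finset.sum_sub_distrib _ _

theorem sum_add (P : TaggedPartition a b) (h k : EReal → EReal → EReal → ℝ) :
    P.sum (fun t u v => h t u v + k t u v) = P.sum h + P.sum k :=
  Finset.sum_add_distrib

theorem abs_sum_le (P : TaggedPartition a b) (h : EReal → EReal → EReal → ℝ) :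
    |P.sum h| ≤ P.sum (fun t u v => |h t u v|) :=
  Finset.abs_sum_le_sum_abs _ _

theorem sum_le_sum {P : TaggedPartition a b} {U : EReal → Set EReal} (hP : P.IsFine U)
    {h k : EReal → EReal → EReal → ℝ}
    (hk : ∀ t u v, u ≤ t → t ≤ v → Set.Icc u v ⊆ U t → h t u v ≤ k t u v) : P.sum h ≤ P.sum k :=
  Finset.sum_le_sum fun i hi => hk _ _ _ (P.tag_mem i (Finset.mem_range.1 hi)).1
    (P.tag_mem i (Finset.mem_range.1 hi)).2 (hP i (Finset.mem_range.1 hi))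

/-- Used to keep some cells of a partition and subdivide the others at will, the pieces being glued
from left to right. -/
theorem exists_refine (P : TaggedPartition a b) {U : EReal → Set EReal}
    {h : EReal → EReal → EReal → ℝ} {s : ℕ → ℝ}
    (hR : ∀ i < P.n, ∃ R : TaggedPartition (P.pt i) (P.pt (i + 1)), R.IsFine U ∧ R.sum h = s i) :
    ∃ Q : TaggedPartition a b, Q.IsFine U ∧ Q.sum h = ∑ i ∈ Finset.range P.n, s i := by
  have key : ∀ k ≤ P.n, ∃ Q : TaggedPartition (P.pt 0) (P.pt k), Q.IsFine U ∧
      Q.sum h = ∑ i ∈ Finset.range k, s i := by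
    intro k
    induction k with
    | zero => exact fun _ => ⟨nil _, isFine_nil _ _, sum_nil _ _⟩
    | succ k ih =>
      intro hk
      obtain ⟨Q, hQ, hQs⟩ := ih (by omega)
      obtain ⟨R, hRf, hRs⟩ := hR k (by omega)
      exact ⟨Q.append R, hQ.append hRf, by rw [sum_append, hQs, hRs, Finset.sum_range_succ]⟩
  have := key P.n le_rfl
  rwa [P.pt_zero, P.pt_last] at this

theorem exists_refine_of_le (P : TaggedPartition a b) {U : EReal → Set EReal}
    {h : EReal → EReal → EReal → ℝ} {s : ℕ → ℝ}
    (hR : ∀ i < P.n, ∃ R : TaggedPartition (P.pt i) (P.pt (i + 1)), R.IsFine U ∧ s i ≤ R.sum h) :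
    ∃ Q : TaggedPartition a b, Q.IsFine U ∧ ∑ i ∈ Finset.range P.n, s i ≤ Q.sum h := by
  have : ∀ i, ∃ r, i < P.n → (∃ R : TaggedPartition (P.pt i) (P.pt (i + 1)),
      R.IsFine U ∧ R.sum h = r) ∧ s i ≤ r := by
    intro i
    by_cases hi : i < P.n
    · obtain ⟨R, hRf, hRs⟩ := hR i hi
      exact ⟨_, fun _ => ⟨⟨R, hRf, rfl⟩, hRs⟩⟩
    · exact ⟨0, fun h => absurd h hi⟩
  choose r hr using this
  obtain ⟨Q, hQ, hQs⟩ := P.exists_refine fun i hi => (hr i hi).1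
  exact ⟨Q, hQ, hQs ▸ Finset.sum_le_sum fun i hi => (hr i (Finset.mem_range.1 hi)).2⟩

end TaggedPartition

/-! ### Interval functions of variation zero -/

open Classical in
/-- The function `h` of tagged intervals has variation zero on the set `E` of tags. -/
def NullOn (h : EReal → EReal → EReal → ℝ) (E : Set EReal) : Prop :=
  ∀ ε > 0, ∃ U, IsGauge U ∧ ∀ P : TaggedPartition ⊥ ⊤, P.IsFine U →
    P.sum (fun t u v => if t ∈ E then |h t u v| else 0) ≤ ε

namespace NullOn

variable {h k : EReal → EReal → EReal → ℝ} {E : Set EReal}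

/-- Each tag gets the gauge belonging to the first set that contains it, with tolerance `ε / 2 / 2 ^
m` for the `m`-th set. The cells using the `m`-th gauge are completed to a full fine partition,
which only adds nonnegative terms. -/
theorem iUnion {E : ℕ → Set EReal} (hE : ∀ m, NullOn h (E m)) : NullOn h (⋃ m, E m) := by
  classical
  intro ε hε
  have hpos : ∀ m : ℕ, 0 < ε / 2 / 2 ^ m := fun m => by positivity
  choose U hU hUP using fun m => hE m _ (hpos m)
  let N : EReal → ℕ := fun t => if ht : ∃ m, t ∈ E m then Nat.find ht else 0
  refine ⟨fun t => U (N t) t, ⟨fun t => (hU _).1 t, fun x => (hU _).2 x⟩, fun P hP => ?_⟩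
  have key : ∀ m, ∑ i ∈ Finset.range P.n, (if N (P.tag i) = m ∧ P.tag i ∈ E m then
      |h (P.tag i) (P.pt i) (P.pt (i + 1))| else 0) ≤ ε / 2 / 2 ^ m := by
    intro m
    obtain ⟨Q, hQ, hle⟩ := P.exists_refine_of_le (U := U m)
      (h := fun t u v => if t ∈ E m then |h t u v| else 0)
      (s := fun i => if N (P.tag i) = m ∧ P.tag i ∈ E m then
        |h (P.tag i) (P.pt i) (P.pt (i + 1))| else 0) fun i hi => by
        by_cases hm : N (P.tag i) = m ∧ P.tag i ∈ E m
        · refine ⟨.single _ _ _ (P.tag_mem i hi).1 (P.tag_mem i hi).2,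
            TaggedPartition.isFine_single _ _ (hm.1 ▸ hP i hi), ?_⟩
          simp [TaggedPartition.sum_single, hm]
        -- Cells governed by another gauge are refilled by Cousin's lemma.
        · obtain ⟨R, hR⟩ := TaggedPartition.exists_isFine (hU m).1 (P.pt_le_succ hi)
          refine ⟨R, hR, ?_⟩
          simp only [hm, if_false]
          refine Finset.sum_nonneg fun j _ => ?_
          beta_reduce
          split_ifs <;> positivity
    exact hle.trans (hUP m Q hQ)
  have hN : ∀ t, t ∈ ⋃ m, E m → t ∈ E (N t) := by
    intro t ht
    have ht' := Set.mem_iUnion.1 ht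
    simp only [N, dif_pos ht']
    exact Nat.find_spec ht'
  obtain ⟨M, hM⟩ : ∃ M, ∀ i ∈ Finset.range P.n, N (P.tag i) < M :=
    ⟨(Finset.range P.n).sup (fun i => N (P.tag i)) + 1, fun i hi =>
      Nat.lt_succ_of_le (Finset.le_sup (f := fun i => N (P.tag i)) hi)⟩
  calc P.sum (fun t u v => if t ∈ ⋃ m, E m then |h t u v| else 0)
      ≤ ∑ i ∈ Finset.range P.n, ∑ m ∈ Finset.range M,
        (if N (P.tag i) = m ∧ P.tag i ∈ E m then
          |h (P.tag i) (P.pt i) (P.pt (i + 1))| else 0) := by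
        refine Finset.sum_le_sum fun i hi => ?_
        have hnn : ∀ m ∈ Finset.range M, (0 : ℝ) ≤ (if N (P.tag i) = m ∧ P.tag i ∈ E m then
          |h (P.tag i) (P.pt i) (P.pt (i + 1))| else 0) := fun m _ => by
            split_ifs <;> positivity
        beta_reduce
        split_ifs with ht
        · refine le_trans ?_ (Finset.single_le_sum hnn (Finset.mem_range.2 (hM i hi)))
          simp [hN _ ht]
        · exact Finset.sum_nonneg hnn
    _ = ∑ m ∈ Finset.range M, ∑ i ∈ Finset.range P.n,
        (if N (P.tag i) = m ∧ P.tag i ∈ E m then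
          |h (P.tag i) (P.pt i) (P.pt (i + 1))| else 0) := Finset.sum_comm
    _ ≤ ∑ m ∈ Finset.range M, ε / 2 / 2 ^ m := Finset.sum_le_sum fun m _ => key m
    _ ≤ ∑' m : ℕ, ε / 2 / 2 ^ m :=
        (summable_geometric_two' ε).sum_le_tsum _ fun m _ => (hpos m).le
    _ = ε := tsum_geometric_two' ε

theorem mono {E' : Set EReal} (hE : NullOn h E) (hsub : E' ⊆ E) : NullOn h E' := by
  intro ε hε
  obtain ⟨U, hU, hP⟩ := hE ε hε
  refine ⟨U, hU, fun P hPU => (TaggedPartition.sum_le_sum hPU fun t u v _ _ _ => ?_).trans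
    (hP P hPU)⟩
  by_cases h1 : t ∈ E'
  · simp [h1, hsub h1]
  · rw [if_neg h1]
    split_ifs <;> positivity

theorem of_iUnion {E : ℕ → Set EReal} (hE : ∀ m, NullOn h (E m)) (hcov : ∀ t, ∃ m, t ∈ E m) :
    NullOn h Set.univ :=
  (iUnion hE).mono fun t _ => Set.mem_iUnion.2 (hcov t)

/-- A gauge may be shrunk, so only the values on small intervals around each tag count. -/
theorem congr_nhds (hE : NullOn h E)
    (hk : ∀ t ∈ E, ∃ V ∈ 𝓝 t, ∀ u v, u ≤ t → t ≤ v → Set.Icc u v ⊆ V → k t u v = h t u v) :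
    NullOn k E := by
  classical
  intro ε hε
  obtain ⟨U, hU, hP⟩ := hE ε hε
  choose! V hV hVk using hk
  obtain ⟨W, hW, hWV⟩ := exists_gauge_subset (fun t => if t ∈ E then V t else Set.univ) (by
    intro t
    by_cases h : t ∈ E
    · simpa [h] using hV t h
    · simp [h])
  refine ⟨_, hU.inter hW, fun P hPU => (TaggedPartition.sum_le_sum hPU
    fun t u v hut htv hs => ?_).trans (hP P (hPU.mono fun t => Set.inter_subset_left))⟩
  by_cases ht : t ∈ E
  · have := hVk t ht u v hut htv (hs.trans (Set.inter_subset_right.trans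
      ((hWV t).trans (by simp [ht]))))
    simp [ht, this]
  · simp [ht]

theorem add (hh : NullOn h E) (hk : NullOn k E) :
    NullOn (fun t u v => h t u v + k t u v) E := by
  intro ε hε
  obtain ⟨U, hU, hP⟩ := hh _ (half_pos hε)
  obtain ⟨V, hV, hQ⟩ := hk _ (half_pos hε)
  refine ⟨_, hU.inter hV, fun P hPU => ?_⟩
  have h1 := hP P (hPU.mono fun t => Set.inter_subset_left)
  have h2 := hQ P (hPU.mono fun t => Set.inter_subset_right)
  have h3 := (P.sum_add _ _).trans_le (add_le_add h1 h2)
  rw [add_halves] at h3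
  refine (TaggedPartition.sum_le_sum hPU fun t u v _ _ _ => ?_).trans h3
  beta_reduce
  split_ifs
  · exact abs_add_le (h t u v) (k t u v)
  · simp

theorem neg (hh : NullOn h E) : NullOn (fun t u v => - h t u v) E := by
  simpa only [NullOn, abs_neg] using hh

theorem zero : NullOn (fun _ _ _ => 0) E := fun ε hε =>
  ⟨_, (exists_gauge_subset (fun _ => Set.univ) fun _ => univ_mem).choose_spec.1, fun P _ => by
    simpa [TaggedPartition.sum] using hε.le⟩

/-- At most one cell tagged `x` extends to the left of `x` and at most one to the right; each
contributes at most `ε / 2`. Degenerate cells may repeat, but `hx` makes them vanish. -/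
theorem singleton {x : EReal} (hx : h x x x = 0)
    (hh : ∀ ε > 0, ∃ V ∈ 𝓝 x, ∀ u ∈ V, ∀ v ∈ V, |h x u v| ≤ ε) : NullOn h {x} := by
  classical
  intro ε hε
  obtain ⟨V, hV, hVh⟩ := hh _ (half_pos hε)
  obtain ⟨U, hU, hUV⟩ := exists_gauge_subset (fun t => if t = x then V else Set.univ) (by
    intro t
    by_cases h : t = x
    · simpa [h] using hV
    · simp [h])
  refine ⟨U, hU, fun P hP => ?_⟩
  set A := (Finset.range P.n).filter (fun i => P.tag i = x ∧ P.pt i < x) with hA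
  set B := (Finset.range P.n).filter (fun i => P.tag i = x ∧ x < P.pt (i + 1)) with hB
  have hAc : A.card ≤ 1 := by
    refine Finset.card_le_one.2 fun i hi j hj => ?_
    wlog hij : i ≤ j generalizing i j
    · exact (this j hj i hi (not_le.1 hij).le).symm
    simp only [hA, Finset.mem_filter, Finset.mem_range] at hi hj
    by_contra hne
    have h1 := (P.tag_mem i hi.1).2
    have h2 := P.pt_mono (show i + 1 ≤ j by omega) hj.1.le
    rw [hi.2.1] at h1
    exact absurd (h1.trans h2) (not_le.2 hj.2.2)
  have hBc : B.card ≤ 1 := by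
    refine Finset.card_le_one.2 fun i hi j hj => ?_
    wlog hij : i ≤ j generalizing i j
    · exact (this j hj i hi (not_le.1 hij).le).symm
    simp only [hB, Finset.mem_filter, Finset.mem_range] at hi hj
    by_contra hne
    have h1 := (P.tag_mem j hj.1).1
    have h2 := P.pt_mono (show i + 1 ≤ j by omega) hj.1.le
    rw [hj.2.1] at h1
    exact absurd (h2.trans h1) (not_le.2 hi.2.2)
  refine le_trans (Finset.sum_le_sum (g := fun i =>
    (if P.tag i = x ∧ P.pt i < x then ε / 2 else 0) +
      (if P.tag i = x ∧ x < P.pt (i + 1) then ε / 2 else 0)) fun i hi => ?_) ?_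
  · have hi' := Finset.mem_range.1 hi
    beta_reduce
    by_cases ht : P.tag i = x
    · have hm := P.tag_mem i hi'
      have hf := (hP i hi').trans (hUV _)
      rw [ht] at hm hf
      rw [if_pos rfl] at hf
      have hb := hVh _ (hf (Set.left_mem_Icc.2 (P.pt_le_succ hi'))) _
        (hf (Set.right_mem_Icc.2 (P.pt_le_succ hi')))
      by_cases h1 : P.pt i < x
      · have : (0 : ℝ) ≤ if x < P.pt (i + 1) then ε / 2 else 0 := by split_ifs <;> positivity
        simp only [ht, h1, Set.mem_singleton_iff, true_and, if_true]
        linarith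
      · by_cases h2 : x < P.pt (i + 1)
        · simpa [ht, h1, h2] using hb
        · have e1 : P.pt i = x := le_antisymm hm.1 (not_lt.1 h1)
          have e2 : P.pt (i + 1) = x := le_antisymm (not_lt.1 h2) hm.2
          simp [ht, e1, e2, hx]
    · simp [ht]
  rw [Finset.sum_add_distrib, ← Finset.sum_filter, ← Finset.sum_filter, Finset.sum_const,
    Finset.sum_const, nsmul_eq_mul, nsmul_eq_mul]
  have h1 : (A.card : ℝ) ≤ 1 := by exact_mod_cast hAc
  have h2 : (B.card : ℝ) ≤ 1 := by exact_mod_cast hBc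
  nlinarith

end NullOn
-- Primitives and the Saks–Henstock lemma
/-- The function `φ(t) · (v - u)` of a tagged interval. -/
noncomputable def density (φ : EReal → ℝ) (t u v : EReal) : ℝ := φ t * (v.toReal - u.toReal)

theorem riemannSum_eq_sum {a b : EReal} (P : TaggedPartition a b) (f : ℝ → ℝ) :
    P.riemannSum f = P.sum (density (extendZero f a b)) := rfl

/-- `F` is an indefinite Henstock–Kurzweil integral of `φ`. -/
def IsPrimitive (φ F : EReal → ℝ) : Prop :=
  NullOn (fun t u v => density φ t u v - (F v - F u)) Set.univ

theorem NullOn.exists_abs_sum_le {h : EReal → EReal → EReal → ℝ} (hh : NullOn h Set.univ)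
    {ε : ℝ} (hε : 0 < ε) : ∃ U, IsGauge U ∧ ∀ P : TaggedPartition ⊥ ⊤, P.IsFine U →
      P.sum (fun t u v => |h t u v|) ≤ ε := by
  simpa using hh ε hε

/-- The Saks–Henstock lemma. -/
theorem exists_nullOn_sub {h : EReal → EReal → EReal → ℝ} {A : ℝ}
    (hA : ∀ ε > 0, ∃ U, IsGauge U ∧ ∀ P : TaggedPartition ⊥ ⊤, P.IsFine U → |P.sum h - A| < ε) :
    ∃ F : EReal → ℝ, F ⊥ = 0 ∧ F ⊤ = A ∧
      NullOn (fun t u v => h t u v - (F v - F u)) Set.univ := by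
  -- `F v` will be the limit of the sums over partitions of `[⊥, v]` along the filter of ever finer
  -- gauges.
  let l : (v : EReal) → Filter (TaggedPartition ⊥ v) := fun v =>
    ⨅ (U) (_ : IsGauge U), 𝓟 {P | P.IsFine U}
  have hl : ∀ v, (l v).HasBasis IsGauge (fun U => {P | P.IsFine U}) := fun v =>
    hasBasis_biInf_principal (s := fun U => {P : TaggedPartition ⊥ v | P.IsFine U})
      (S := {U | IsGauge U}) (fun U hU V hV => ⟨_, hU.inter hV,
        fun P (hP : P.IsFine _) => hP.mono fun t => Set.inter_subset_left,
        fun P (hP : P.IsFine _) => hP.mono fun t => Set.inter_subset_right⟩)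
      ⟨_, (exists_gauge_subset (fun _ => Set.univ) fun _ => univ_mem).choose_spec.1⟩
  have hne : ∀ v, (l v).NeBot := fun v => (hl v).neBot_iff.2 fun hU =>
    TaggedPartition.exists_isFine hU.1 bot_le
  have hlim : ∀ v, ∃ B, Tendsto (fun P : TaggedPartition ⊥ v => P.sum h) (l v) (𝓝 B) := by
    intro v
    have := hne v
    refine cauchy_map_iff_exists_tendsto.1 (Metric.cauchy_iff.2 ⟨inferInstance, fun ε hε => ?_⟩)
    obtain ⟨U, hU, hP⟩ := hA _ (half_pos hε)
    refine ⟨_, image_mem_map ((hl v).mem_of_mem hU), ?_⟩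
    rintro _ ⟨P, hPf, rfl⟩ _ ⟨Q, hQf, rfl⟩
    -- A common completion to the whole line cancels in the difference and gives the Cauchy
    -- property.
    obtain ⟨R, hR⟩ := TaggedPartition.exists_isFine hU.1 (le_top (a := v))
    have h1 := hP _ (TaggedPartition.IsFine.append hPf hR)
    have h2 := hP _ (TaggedPartition.IsFine.append hQf hR)
    rw [TaggedPartition.sum_append, abs_lt] at h1 h2
    rw [Real.dist_eq, abs_lt]
    constructor <;> linarith
  choose F hF using hlim
  have hF' : ∀ v, ∀ ε > 0, ∃ U, IsGauge U ∧ ∀ P : TaggedPartition ⊥ v, P.IsFine U →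
      |P.sum h - F v| < ε := by
    intro v ε hε
    obtain ⟨U, hU, hP⟩ := ((hl v).tendsto_iff Metric.nhds_basis_ball).1 (hF v) ε hε
    exact ⟨U, hU, fun P hPU => hP P hPU⟩
  have hbot : F ⊥ = 0 := by
    by_contra hne
    obtain ⟨U, hU, hP⟩ := hF' ⊥ |F ⊥| (abs_pos.2 hne)
    simpa [TaggedPartition.sum_nil] using hP _ (TaggedPartition.isFine_nil _ _)
  have htop : F ⊤ = A := by
    have := hne ⊤
    refine tendsto_nhds_unique (hF ⊤) (((hl ⊤).tendsto_iff Metric.nhds_basis_ball).2 ?_)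
    intro ε hε
    obtain ⟨U, hU, hP⟩ := hA ε hε
    exact ⟨U, hU, fun P hPU => hP P hPU⟩
  have happrox : ∀ {U}, IsGauge U → ∀ η > 0, ∀ {u v : EReal}, u ≤ v →
      ∃ P : TaggedPartition u v, P.IsFine U ∧ |P.sum h - (F v - F u)| ≤ η := by
    intro U hU η hη u v huv
    obtain ⟨U1, hU1, hP1⟩ := hF' u _ (half_pos hη)
    obtain ⟨U2, hU2, hP2⟩ := hF' v _ (half_pos hη)
    have hg := (hU.inter hU1).inter hU2
    obtain ⟨P, hP⟩ := TaggedPartition.exists_isFine hg.1 huv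
    obtain ⟨Q, hQ⟩ := TaggedPartition.exists_isFine hg.1 (bot_le (a := u))
    have h1 := hP1 Q (hQ.mono fun t y hy => hy.1.2)
    have h2 := hP2 (Q.append P) ((hQ.append hP).mono fun t y hy => hy.2)
    rw [TaggedPartition.sum_append] at h2
    refine ⟨P, hP.mono fun t y hy => hy.1.1, ?_⟩
    rw [abs_lt] at h1 h2
    rw [abs_le]
    constructor <;> linarith
  refine ⟨F, hbot, htop, fun ε hε => ?_⟩
  obtain ⟨U, hU, hUP⟩ := hA _ (half_pos hε)
  refine ⟨U, hU, fun P hP => ?_⟩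
  -- Keep the cells in `J` and replace each other cell by a fine partition whose sum is close to the
  -- increment of `F`, with total error at most `δ`. The result is a fine partition of the whole
  -- line, so the error over `J` alone is at most `ε / 2 + δ`.
  have key : ∀ J : ℕ → Prop, ∀ _ : DecidablePred J,
      |∑ i ∈ Finset.range P.n, if J i then
        h (P.tag i) (P.pt i) (P.pt (i + 1)) - (F (P.pt (i + 1)) - F (P.pt i)) else 0| ≤ ε / 2 := by
    intro J _
    refine le_of_forall_pos_le_add fun δ hδ => ?_
    have hη : 0 < δ / (P.n + 1) := by positivity
    have hs : ∀ i, ∃ s, i < P.n → (∃ R : TaggedPartition (P.pt i) (P.pt (i + 1)),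
        R.IsFine U ∧ R.sum h = s) ∧ |s - (if J i then h (P.tag i) (P.pt i) (P.pt (i + 1))
          else F (P.pt (i + 1)) - F (P.pt i))| ≤ δ / (P.n + 1) := by
      intro i
      by_cases hi : i < P.n
      · by_cases hJ : J i
        · refine ⟨h (P.tag i) (P.pt i) (P.pt (i + 1)), fun _ => ⟨⟨.single _ _ _
            (P.tag_mem i hi).1 (P.tag_mem i hi).2, TaggedPartition.isFine_single _ _ (hP i hi),
            TaggedPartition.sum_single _ _ _⟩, ?_⟩⟩
          simpa [hJ] using hη.le
        · obtain ⟨R, hR, hRs⟩ := happrox hU _ hη (P.pt_le_succ hi)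
          exact ⟨_, fun _ => ⟨⟨R, hR, rfl⟩, by simpa [hJ] using hRs⟩⟩
      · exact ⟨0, fun h => absurd h hi⟩
    choose s hs using hs
    obtain ⟨Q, hQ, hQs⟩ := P.exists_refine fun i hi => (hs i hi).1
    have h1 := hUP Q hQ
    have h2 : |∑ i ∈ Finset.range P.n, (s i - (if J i then h (P.tag i) (P.pt i) (P.pt (i + 1))
          else F (P.pt (i + 1)) - F (P.pt i)))| ≤ δ := by
      refine (Finset.abs_sum_le_sum_abs _ _).trans ((Finset.sum_le_sum fun i hi =>
        (hs i (Finset.mem_range.1 hi)).2).trans ?_)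
      rw [Finset.sum_const, Finset.card_range, nsmul_eq_mul, mul_div_assoc', div_le_iff₀
        (by positivity)]
      nlinarith
    have h3 := P.sum_telescope F
    rw [hbot, htop, sub_zero, TaggedPartition.sum] at h3
    have h4 : (∑ i ∈ Finset.range P.n, if J i then
        h (P.tag i) (P.pt i) (P.pt (i + 1)) - (F (P.pt (i + 1)) - F (P.pt i)) else 0) =
        (∑ i ∈ Finset.range P.n, if J i then h (P.tag i) (P.pt i) (P.pt (i + 1))
          else F (P.pt (i + 1)) - F (P.pt i)) - A := by
      rw [← h3, ← Finset.sum_sub_distrib]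
      refine Finset.sum_congr rfl fun i _ => ?_
      split_ifs <;> simp
    rw [Finset.sum_sub_distrib, ← hQs] at h2
    rw [h4]
    rw [abs_lt] at h1
    rw [abs_le] at h2 ⊢
    constructor <;> linarith
  classical
  -- Splitting the cells by the sign of the error bounds the sum of absolute values by twice `ε /
  -- 2`.
  have k1 := key (fun i => 0 ≤ h (P.tag i) (P.pt i) (P.pt (i + 1)) -
    (F (P.pt (i + 1)) - F (P.pt i))) (Classical.decPred _)
  have k2 := key (fun i => ¬ 0 ≤ h (P.tag i) (P.pt i) (P.pt (i + 1)) -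
    (F (P.pt (i + 1)) - F (P.pt i))) (Classical.decPred _)
  have k3 := (le_abs_self _).trans k1
  have k4 := (neg_le_abs _).trans k2
  rw [← Finset.sum_neg_distrib] at k4
  have k5 := add_le_add k3 k4
  rw [add_halves, ← Finset.sum_add_distrib] at k5
  refine (Finset.sum_le_sum fun i hi => ?_).trans k5
  beta_reduce
  rw [if_pos (Set.mem_univ _)]
  by_cases h0 : 0 ≤ h (P.tag i) (P.pt i) (P.pt (i + 1)) - (F (P.pt (i + 1)) - F (P.pt i))
  · simp [h0, abs_of_nonneg h0]
  · simp [h0, abs_of_neg (not_le.1 h0)]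

namespace IsPrimitive

variable {φ ψ F G : EReal → ℝ}

theorem exists_abs_sum_sub_lt (hF : IsPrimitive φ F) {ε : ℝ} (hε : 0 < ε) :
    ∃ U, IsGauge U ∧ ∀ P : TaggedPartition ⊥ ⊤, P.IsFine U →
      |P.sum (density φ) - (F ⊤ - F ⊥)| < ε := by
  obtain ⟨U, hU, hP⟩ := NullOn.exists_abs_sum_le hF (half_pos hε)
  refine ⟨U, hU, fun P hPU => ?_⟩
  rw [← P.sum_telescope F, ← P.sum_sub]
  exact ((P.abs_sum_le _).trans (hP P hPU)).trans_lt (half_lt_self hε)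

theorem unique (hF : IsPrimitive φ F) (hG : IsPrimitive φ G) : F ⊤ - F ⊥ = G ⊤ - G ⊥ := by
  refine eq_of_forall_dist_le fun ε hε => ?_
  obtain ⟨U, hU, hP⟩ := hF.exists_abs_sum_sub_lt (half_pos hε)
  obtain ⟨V, hV, hQ⟩ := hG.exists_abs_sum_sub_lt (half_pos hε)
  obtain ⟨P, hPf⟩ := TaggedPartition.exists_isFine (hU.inter hV).1 (bot_le (a := (⊤ : EReal)))
  have h1 := hP P (hPf.mono fun t => Set.inter_subset_left)
  have h2 := hQ P (hPf.mono fun t => Set.inter_subset_right)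
  rw [Real.dist_eq]
  rw [abs_lt] at h1 h2
  rw [abs_le]
  constructor <;> linarith

theorem add (hF : IsPrimitive φ F) (hG : IsPrimitive ψ G) :
    IsPrimitive (fun t => φ t + ψ t) (fun t => F t + G t) := by
  refine (NullOn.add hF hG).congr_nhds fun t _ => ⟨_, univ_mem, fun u v _ _ _ => ?_⟩
  simp only [density]
  ring

theorem neg (hF : IsPrimitive φ F) : IsPrimitive (fun t => - φ t) (fun t => - F t) := by
  refine (NullOn.neg hF).congr_nhds fun t _ => ⟨_, univ_mem, fun u v _ _ _ => ?_⟩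
  simp only [density]
  ring

theorem sub (hF : IsPrimitive φ F) (hG : IsPrimitive ψ G) :
    IsPrimitive (fun t => φ t - ψ t) (fun t => F t - G t) := by
  simpa only [sub_eq_add_neg] using hF.add hG.neg

theorem zero : IsPrimitive (fun _ => 0) (fun _ => 0) := by
  simpa [IsPrimitive, density] using NullOn.zero (E := Set.univ)

theorem sum {φ F : ℕ → EReal → ℝ} (h : ∀ k, IsPrimitive (φ k) (F k)) (m : ℕ) :
    IsPrimitive (fun t => ∑ k ∈ Finset.range m, φ k t) (fun t => ∑ k ∈ Finset.range m, F k t) := by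
  induction m with
  | zero => simpa using zero
  | succ m ih => simpa only [Finset.sum_range_succ] using ih.add (h m)

end IsPrimitive

/-! ### Continuity of primitives -/

/-- `EReal.toReal` is continuous only at finite points; at the infinite ones the vanishing of `φ`
takes over. -/
theorem tendsto_density {φ : EReal → ℝ} (hb : φ ⊥ = 0) (ht : φ ⊤ = 0) (x : EReal) :
    Tendsto (fun p : EReal × EReal => density φ x p.1 p.2) (𝓝 (x, x)) (𝓝 0) := by
  by_cases h1 : x = ⊥
  · simp [density, h1, hb]
  by_cases h2 : x = ⊤
  · simp [density, h2, ht]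
  have h := EReal.tendsto_toReal h2 h1
  have := ((h.comp (tendsto_snd (f := 𝓝 x) (g := 𝓝 x))).sub
    (h.comp (tendsto_fst (f := 𝓝 x) (g := 𝓝 x)))).const_mul (φ x)
  rw [nhds_prod_eq]
  simpa [density] using this

theorem nullOn_singleton {φ F : EReal → ℝ} (hb : φ ⊥ = 0) (ht : φ ⊤ = 0) {x : EReal}
    (hF : ContinuousAt F x) :
    NullOn (fun t u v => density φ t u v - (F v - F u)) {x} := by
  refine NullOn.singleton (by simp [density]) fun ε hε => ?_
  have h1 : Tendsto (fun p : EReal × EReal => density φ x p.1 p.2 - (F p.2 - F p.1))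
      (𝓝 x ×ˢ 𝓝 x) (𝓝 0) := by
    have h2 := (hF.tendsto.comp (tendsto_snd (f := 𝓝 x) (g := 𝓝 x))).sub
      (hF.tendsto.comp (tendsto_fst (f := 𝓝 x) (g := 𝓝 x)))
    have h3 := tendsto_density hb ht x
    rw [nhds_prod_eq] at h3
    simpa using h3.sub h2
  obtain ⟨V, hV, hVh⟩ := (eventually_prod_self_iff'.1
    (h1.eventually (Metric.closedBall_mem_nhds 0 hε)))
  exact ⟨V, hV, fun u hu v hv => by simpa using hVh u hu v hv⟩

/-- Any single small cell tagged `x` extends to a fine partition of the line, so its own error is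
small, and so is its density term. -/
theorem IsPrimitive.continuous {φ F : EReal → ℝ} (hF : IsPrimitive φ F) (hb : φ ⊥ = 0)
    (ht : φ ⊤ = 0) : Continuous F := by
  refine continuous_iff_continuousAt.2 fun x => ?_
  have hd : Tendsto (fun y => density φ x x y) (𝓝 x) (𝓝 0) := by
    have := (tendsto_density hb ht x).comp
      (tendsto_const_nhds.prodMk_nhds tendsto_id : Tendsto (fun y => (x, y)) (𝓝 x) (𝓝 (x, x)))
    simpa [Function.comp_def] using this
  suffices h : Tendsto (fun y => density φ x x y - (F y - F x)) (𝓝 x) (𝓝 0) by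
    have h1 := (hd.sub h).add_const (F x)
    simpa [ContinuousAt] using h1
  refine Metric.tendsto_nhds.2 fun ε hε => ?_
  obtain ⟨U, hU, hP⟩ := NullOn.exists_abs_sum_le hF (half_pos hε)
  have hI : ∀ᶠ y in 𝓝 x, Set.uIcc x y ⊆ U x :=
    eventually_smallSets_subset.2 (hU.1 x) |> (tendsto_const_nhds.uIcc tendsto_id).eventually
  have key : ∀ u v, u ≤ x → x ≤ v → Set.Icc u v ⊆ U x →
      |density φ x u v - (F v - F u)| ≤ ε / 2 := by
    intro u v hu hv hs
    obtain ⟨P, hPf⟩ := TaggedPartition.exists_isFine hU.1 (bot_le (a := u))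
    obtain ⟨Q, hQf⟩ := TaggedPartition.exists_isFine hU.1 (le_top (a := v))
    have h1 := hP _ ((hPf.append (TaggedPartition.isFine_single hu hv hs)).append hQf)
    rw [TaggedPartition.sum_append, TaggedPartition.sum_append,
      TaggedPartition.sum_single] at h1
    have h2 : 0 ≤ P.sum (fun t u v => |density φ t u v - (F v - F u)|) :=
      Finset.sum_nonneg fun _ _ => abs_nonneg _
    have h3 : 0 ≤ Q.sum (fun t u v => |density φ t u v - (F v - F u)|) :=
      Finset.sum_nonneg fun _ _ => abs_nonneg _
    linarith
  filter_upwards [hI] with y hy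
  rw [dist_zero_right, Real.norm_eq_abs]
  refine lt_of_le_of_lt ?_ (half_lt_self hε)
  rcases le_total x y with h | h
  · exact key x y le_rfl h (by rwa [Set.uIcc_of_le h] at hy)
  · have := key y x h le_rfl (by rwa [Set.uIcc_of_ge h] at hy)
    rw [← abs_neg] at this
    refine le_of_eq_of_le (congrArg _ ?_) this
    simp only [density]
    ring

/-! ### Restriction to subintervals and comparison with the integral -/

/-- The projection of the extended real line onto `[c, d]`. -/
noncomputable def clamp (c d y : EReal) : EReal := max c (min y d)

theorem clamp_of_mem {c d y : EReal} (hc : c ≤ y) (hd : y ≤ d) : clamp c d y = y := by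
  simp [clamp, hc, hd]

theorem clamp_of_le {c d y : EReal} (hy : y ≤ c) : clamp c d y = c := by
  simp [clamp, hy]

theorem clamp_of_ge {c d y : EReal} (hcd : c ≤ d) (hy : d ≤ y) : clamp c d y = d := by
  simp [clamp, hy, hcd]

theorem clamp_mono (c d : EReal) : Monotone (clamp c d) := fun _ _ h =>
  max_le_max le_rfl (min_le_min h le_rfl)

theorem clamp_mem {c d : EReal} (hcd : c ≤ d) (y : EReal) : clamp c d y ∈ Set.Icc c d :=
  ⟨le_max_left _ _, max_le hcd (min_le_right _ _)⟩

theorem continuous_clamp (c d : EReal) : Continuous (clamp c d) :=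
  continuous_const.max (continuous_id.min continuous_const)

theorem extendZero_bot (f : ℝ → ℝ) (a b : EReal) : extendZero f a b ⊥ = 0 := by
  simp [extendZero]

theorem extendZero_top (f : ℝ → ℝ) (a b : EReal) : extendZero f a b ⊤ = 0 := by
  simp [extendZero]

theorem extendZero_left (f : ℝ → ℝ) (a b : EReal) : extendZero f a b a = 0 := by
  simp [extendZero]

theorem extendZero_right (f : ℝ → ℝ) (a b : EReal) : extendZero f a b b = 0 := by
  simp [extendZero]

theorem extendZero_of_notMem (f : ℝ → ℝ) {a b t : EReal} (ht : t ∉ Set.Ioo a b) :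
    extendZero f a b t = 0 := if_neg ht

/-- Locally inside (c, d) nothing changes, and locally outside [c, d] both terms vanish. The two end
points are handled by continuity. -/
theorem IsPrimitive.indicator_Ioo {φ F : EReal → ℝ} (hF : IsPrimitive φ F) (hb : φ ⊥ = 0)
    (ht : φ ⊤ = 0) {c d : EReal} (hcd : c ≤ d) :
    IsPrimitive ((Set.Ioo c d).indicator φ) (fun y => F (clamp c d y)) := by
  have hFc : Continuous fun y => F (clamp c d y) :=
    (hF.continuous hb ht).comp (continuous_clamp c d)
  have hb' : (Set.Ioo c d).indicator φ ⊥ = 0 := by simp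
  have ht' : (Set.Ioo c d).indicator φ ⊤ = 0 := by simp
  let E : ℕ → Set EReal := fun m => match m with
    | 0 => Set.Ioo c d
    | 1 => {c}
    | 2 => {d}
    | _ => Set.Iio c ∪ Set.Ioi d
  refine NullOn.of_iUnion (E := E) ?_ fun t => ?_
  · rintro (_ | _ | _ | m)
    · refine (NullOn.mono hF (Set.subset_univ _)).congr_nhds fun t ht =>
        ⟨_, isOpen_Ioo.mem_nhds ht, fun u v hu hv hs => ?_⟩
      have h1 := hs (Set.left_mem_Icc.2 (hu.trans hv))
      have h2 := hs (Set.right_mem_Icc.2 (hu.trans hv))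
      beta_reduce
      rw [clamp_of_mem h1.1.le h1.2.le, clamp_of_mem h2.1.le h2.2.le, density, density,
        Set.indicator_of_mem (s := Set.Ioo c d) ht]
    · exact nullOn_singleton hb' ht' hFc.continuousAt
    · exact nullOn_singleton hb' ht' hFc.continuousAt
    · refine NullOn.zero.congr_nhds fun t ht => ?_
      rcases ht with ht | ht
      · refine ⟨_, isOpen_Iio.mem_nhds ht, fun u v hu hv hs => ?_⟩
        have h1 : u < c := hs (Set.left_mem_Icc.2 (hu.trans hv))
        have h2 : v < c := hs (Set.right_mem_Icc.2 (hu.trans hv))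
        beta_reduce
        rw [clamp_of_le h1.le, clamp_of_le h2.le, density,
          Set.indicator_of_notMem fun h => absurd h.1 (not_lt.2 (le_of_lt ht))]
        simp
      · refine ⟨_, isOpen_Ioi.mem_nhds ht, fun u v hu hv hs => ?_⟩
        have h1 : d < u := hs (Set.left_mem_Icc.2 (hu.trans hv))
        have h2 : d < v := hs (Set.right_mem_Icc.2 (hu.trans hv))
        beta_reduce
        rw [clamp_of_ge hcd h1.le, clamp_of_ge hcd h2.le, density,
          Set.indicator_of_notMem fun h => absurd h.2 (not_lt.2 (le_of_lt ht))]
        simp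
  · rcases lt_trichotomy t c with h | h | h
    · exact ⟨3, Or.inl h⟩
    · exact ⟨1, h⟩
    · rcases lt_trichotomy t d with h' | h' | h'
      · exact ⟨0, h, h'⟩
      · exact ⟨2, h'⟩
      · exact ⟨3, Or.inr h'⟩

/-- A fine partition of [a, b] is completed to the whole line by cells with tags outside (a, b),
whose terms are zero. -/
theorem IsPrimitive.hasIntegral {f : ℝ → ℝ} {a b : EReal} {F : EReal → ℝ}
    (hF : IsPrimitive (extendZero f a b) F) : HasIntegral f a b (F ⊤ - F ⊥) := by
  intro ε hε
  obtain ⟨U, hU, hP⟩ := hF.exists_abs_sum_sub_lt hε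
  refine ⟨U, hU, fun P hPU => ?_⟩
  obtain ⟨Q, hQ⟩ := TaggedPartition.exists_isFine hU.1 (bot_le (a := a))
  obtain ⟨R, hR⟩ := TaggedPartition.exists_isFine hU.1 (le_top (a := b))
  have hQ0 : Q.sum (density (extendZero f a b)) = 0 := by
    refine Finset.sum_eq_zero fun i hi => ?_
    have hi := Finset.mem_range.1 hi
    have h1 := (Q.tag_mem i hi).2.trans ((Q.pt_mono (j := Q.n) hi le_rfl).trans_eq Q.pt_last)
    rw [density, extendZero_of_notMem f fun h => absurd h.1 (not_lt.2 h1), zero_mul]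
  have hR0 : R.sum (density (extendZero f a b)) = 0 := by
    refine Finset.sum_eq_zero fun i hi => ?_
    have hi := Finset.mem_range.1 hi
    have h1 := R.pt_zero.symm.trans_le ((R.pt_mono (Nat.zero_le i) hi.le).trans (R.tag_mem i hi).1)
    rw [density, extendZero_of_notMem f fun h => absurd h.2 (not_lt.2 h1), zero_mul]
  have h := hP _ ((hQ.append hPU).append hR)
  rwa [TaggedPartition.sum_append, TaggedPartition.sum_append, hQ0, hR0, zero_add, add_zero,
    ← riemannSum_eq_sum] at h

/-- A tagged partition of the extended real line projected onto `[a, b]`. -/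
noncomputable def TaggedPartition.clamp (P : TaggedPartition ⊥ ⊤) {a b : EReal} (hab : a ≤ b) :
    TaggedPartition a b where
  n := P.n
  pt i := HenstockKurzweil.clamp a b (P.pt i)
  tag i := HenstockKurzweil.clamp a b (P.tag i)
  pt_zero := by rw [P.pt_zero, clamp_of_le bot_le]
  pt_last := by rw [P.pt_last, clamp_of_ge hab le_top]
  tag_mem i hi := ⟨clamp_mono _ _ (P.tag_mem i hi).1, clamp_mono _ _ (P.tag_mem i hi).2⟩

theorem HasIntegral.exists_isPrimitive {f : ℝ → ℝ} {a b : EReal} {A : ℝ} (hab : a ≤ b)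
    (hf : HasIntegral f a b A) :
    ∃ F, IsPrimitive (extendZero f a b) F ∧ F ⊥ = 0 ∧ F ⊤ = A := by
  suffices h : ∀ ε > 0, ∃ U, IsGauge U ∧ ∀ P : TaggedPartition ⊥ ⊤, P.IsFine U →
      |P.sum (density (extendZero f a b)) - A| < ε by
    obtain ⟨F, h1, h2, h3⟩ := exists_nullOn_sub h
    exact ⟨F, h3, h1, h2⟩
  intro ε hε
  obtain ⟨U, hU, hP⟩ := hf ε hε
  -- This gauge keeps a cell strictly on the same side of `a` and of `b` as its tag. Projection to
  -- `[a, b]` then collapses cells with outside tags, leaves those with tags inside (a, b) alone,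
  -- and only truncates cells tagged at `a` or `b`, where the integrand is 0.
  obtain ⟨W, hW, hWs⟩ := exists_gauge_subset
    (fun t => {y | (a < t → a < y) ∧ (t < a → y < a) ∧ (b < t → b < y) ∧ (t < b → y < b)})
    (fun t => by
      have h1 : ∀ᶠ y in 𝓝 t, a < t → a < y := by
        by_cases h : a < t
        · filter_upwards [isOpen_Ioi.mem_nhds h] with y hy _ using hy
        · simp [h]
      have h2 : ∀ᶠ y in 𝓝 t, t < a → y < a := by
        by_cases h : t < a
        · filter_upwards [isOpen_Iio.mem_nhds h] with y hy _ using hy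
        · simp [h]
      have h3 : ∀ᶠ y in 𝓝 t, b < t → b < y := by
        by_cases h : b < t
        · filter_upwards [isOpen_Ioi.mem_nhds h] with y hy _ using hy
        · simp [h]
      have h4 : ∀ᶠ y in 𝓝 t, t < b → y < b := by
        by_cases h : t < b
        · filter_upwards [isOpen_Iio.mem_nhds h] with y hy _ using hy
        · simp [h]
      exact h1.and (h2.and (h3.and h4)))
  refine ⟨_, hU.inter hW, fun P hPf => ?_⟩
  have hmem : ∀ i < P.n, ∀ y ∈ Set.Icc (P.pt i) (P.pt (i + 1)), (a < P.tag i → a < y) ∧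
      (P.tag i < a → y < a) ∧ (b < P.tag i → b < y) ∧ (P.tag i < b → y < b) :=
    fun i hi y hy => hWs _ (hPf i hi hy).2
  have hleft : ∀ i < P.n, P.pt i ∈ Set.Icc (P.pt i) (P.pt (i + 1)) := fun i hi =>
    Set.left_mem_Icc.2 (P.pt_le_succ hi)
  have hright : ∀ i < P.n, P.pt (i + 1) ∈ Set.Icc (P.pt i) (P.pt (i + 1)) := fun i hi =>
    Set.right_mem_Icc.2 (P.pt_le_succ hi)
  have hfine : (P.clamp hab).IsFine U := by
    intro i hi
    change Set.Icc (clamp a b (P.pt i)) (clamp a b (P.pt (i + 1))) ⊆ U (clamp a b (P.tag i))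
    have hl := hmem i hi _ (hleft i hi)
    have hr := hmem i hi _ (hright i hi)
    have htag := P.tag_mem i hi
    rcases lt_or_ge (P.tag i) a with h | h
    · rw [clamp_of_le h.le, clamp_of_le (hl.2.1 h).le, clamp_of_le (hr.2.1 h).le, Set.Icc_self,
        Set.singleton_subset_iff]
      exact mem_of_mem_nhds (hU.1 a)
    rcases lt_or_ge b (P.tag i) with h' | h'
    · rw [clamp_of_ge hab h'.le, clamp_of_ge hab (hl.2.2.1 h').le,
        clamp_of_ge hab (hr.2.2.1 h').le, Set.Icc_self, Set.singleton_subset_iff]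
      exact mem_of_mem_nhds (hU.1 b)
    rw [clamp_of_mem h h']
    refine (Set.Icc_subset_Icc ?_ ?_).trans fun y hy => (hPf i hi hy).1
    · rw [clamp, min_eq_left (htag.1.trans h')]
      exact le_max_right _ _
    · exact max_le (h.trans htag.2) (min_le_left _ _)
  have hsum : (P.clamp hab).riemannSum f = P.sum (density (extendZero f a b)) := by
    refine Finset.sum_congr rfl fun i hi => ?_
    have hi := Finset.mem_range.1 hi
    change extendZero f a b (clamp a b (P.tag i)) * ((clamp a b (P.pt (i + 1))).toReal -
      (clamp a b (P.pt i)).toReal) = density _ _ _ _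
    have hl := hmem i hi _ (hleft i hi)
    have hr := hmem i hi _ (hright i hi)
    rw [density]
    rcases le_or_gt (P.tag i) a with h | h
    · rw [clamp_of_le h, extendZero_left, extendZero_of_notMem f fun h' => absurd h'.1 (not_lt.2 h)]
      simp
    rcases le_or_gt b (P.tag i) with h' | h'
    · rw [clamp_of_ge hab h', extendZero_right,
        extendZero_of_notMem f fun h' => absurd h'.2 (not_lt.2 ‹_›)]
      simp
    rw [clamp_of_mem h.le h'.le, clamp_of_mem (hl.1 h).le (hl.2.2.2 h').le,
      clamp_of_mem (hr.1 h).le (hr.2.2.2 h').le]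
  rw [← hsum]
  exact hP _ hfine

theorem HasIntegral.integrable {f : ℝ → ℝ} {a b : EReal} {A : ℝ} (hf : HasIntegral f a b A) :
    Integrable f a b := ⟨A, hf⟩

theorem Integrable.exists_isPrimitive {f : ℝ → ℝ} {a b : EReal} (hab : a ≤ b)
    (hf : Integrable f a b) : ∃ F, IsPrimitive (extendZero f a b) F := by
  obtain ⟨A, hA⟩ := hf
  obtain ⟨F, hF, -⟩ := hA.exists_isPrimitive hab
  exact ⟨F, hF⟩

theorem IsPrimitive.integral_eq {f : ℝ → ℝ} {a b : EReal} (hab : a ≤ b) {F : EReal → ℝ}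
    (hF : IsPrimitive (extendZero f a b) F) : integral f a b = F ⊤ - F ⊥ := by
  have hi : Integrable f a b := ⟨_, hF.hasIntegral⟩
  rw [integral, dif_pos hi]
  obtain ⟨G, hG, h0, h1⟩ := hi.choose_spec.exists_isPrimitive hab
  rw [hF.unique hG, h0, h1, sub_zero]

theorem extendZero_eq_indicator (f : ℝ → ℝ) {a b c d : EReal} (hac : a ≤ c) (hdb : d ≤ b) :
    extendZero f c d = (Set.Ioo c d).indicator (extendZero f a b) := by
  funext t
  by_cases ht : t ∈ Set.Ioo c d
  · rw [Set.indicator_of_mem ht, extendZero, extendZero, if_pos ht,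
      if_pos (Set.Ioo_subset_Ioo hac hdb ht)]
  · rw [Set.indicator_of_notMem ht, extendZero_of_notMem f ht]

theorem extendZero_mul (f : ℝ → ℝ) (W : EReal → ℝ) (a b : EReal) :
    extendZero (fun x => f x * W x) a b = fun t => extendZero f a b t * W t := by
  funext t
  by_cases ht : t ∈ Set.Ioo a b
  · rw [extendZero, extendZero, if_pos ht, if_pos ht,
      EReal.coe_toReal (ht.2.trans_le le_top).ne (bot_le.trans_lt ht.1).ne']
  · rw [extendZero_of_notMem _ ht, extendZero_of_notMem _ ht, zero_mul]

theorem extendZero_sub (f g : ℝ → ℝ) (a b : EReal) :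
    extendZero (fun x => f x - g x) a b = fun t => extendZero f a b t - extendZero g a b t := by
  funext t
  by_cases ht : t ∈ Set.Ioo a b <;> simp [extendZero, ht]

theorem IsPrimitive.integral_Ioo {f : ℝ → ℝ} {a b c d : EReal} {F : EReal → ℝ}
    (hF : IsPrimitive (extendZero f a b) F) (hac : a ≤ c) (hcd : c ≤ d) (hdb : d ≤ b) :
    integral f c d = F d - F c := by
  have h := hF.indicator_Ioo (extendZero_bot _ _ _) (extendZero_top _ _ _) hcd
  rw [← extendZero_eq_indicator f hac hdb] at h
  rw [h.integral_eq hcd, clamp_of_ge hcd le_top, clamp_of_le bot_le]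

theorem Integrable.sub {f g : ℝ → ℝ} {a b : EReal} (hab : a ≤ b) (hf : Integrable f a b)
    (hg : Integrable g a b) : Integrable (fun x => f x - g x) a b ∧
      integral (fun x => f x - g x) a b = integral f a b - integral g a b := by
  obtain ⟨F, hF⟩ := hf.exists_isPrimitive hab
  obtain ⟨G, hG⟩ := hg.exists_isPrimitive hab
  have h := hF.sub hG
  rw [← extendZero_sub] at h
  refine ⟨h.hasIntegral.integrable, ?_⟩
  rw [h.integral_eq hab, hF.integral_eq hab, hG.integral_eq hab]
  ring

/-! ### Multiplication by an infinite sum of indicators -/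

/-- Multiplication by a function that is locally a finite sum of indicators of intervals outside
a point `x`, at which the intervals shrink. -/
theorem IsPrimitive.tsum_indicator {φ F : EReal → ℝ} (hF : IsPrimitive φ F) (hb : φ ⊥ = 0)
    (ht : φ ⊤ = 0) {x : EReal} {c d : ℕ → EReal} (hcd : ∀ k, c k ≤ d k)
    (hc : Tendsto c atTop (𝓝 x)) (hd : Tendsto d atTop (𝓝 x)) {B : ℕ → ℝ} (hB : Summable B)
    (hFB : ∀ k, ∀ y ∈ Set.Icc (c k) (d k), |F y - F (c k)| ≤ B k) :
    IsPrimitive (fun t => φ t * ∑' k, (Set.Ioo (c k) (d k)).indicator 1 t)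
      (fun y => ∑' k, (F (clamp (c k) (d k) y) - F (c k))) := by
  set T : ℕ → EReal → ℝ := fun k y => F (clamp (c k) (d k) y) - F (c k) with hT
  have hFc := hF.continuous hb ht
  have hTB : ∀ k y, ‖T k y‖ ≤ B k := fun k y => hFB k _ (clamp_mem (hcd k) y)
  have hTc : Continuous fun y => ∑' k, T k y :=
    continuous_tsum (fun k => (hFc.comp (continuous_clamp _ _)).sub continuous_const) hB hTB
  have hTs : ∀ y, Summable fun k => T k y := fun y => hB.of_norm_bounded fun k => hTB k y
  have hTk : ∀ k, IsPrimitive ((Set.Ioo (c k) (d k)).indicator φ) (T k) := by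
    intro k
    refine (hF.indicator_Ioo hb ht (hcd k)).congr_nhds fun t _ =>
      ⟨_, univ_mem, fun u v _ _ _ => ?_⟩
    simp [hT]
  -- Near a tag in `E (m + 1)` only the first `m` intervals matter and the finite sum applies. The
  -- exceptional point `x` is covered by continuity of the series, which converges uniformly.
  let E : ℕ → Set EReal := fun m => match m with
    | 0 => {x}
    | m + 1 => {t | ∃ V ∈ 𝓝 t, ∀ k ≥ m, Disjoint V (Set.Icc (c k) (d k))}
  refine NullOn.of_iUnion (E := E) ?_ fun t => ?_
  · rintro (_ | m)
    · exact nullOn_singleton (by simp [hb]) (by simp [ht]) hTc.continuousAt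
    · refine (NullOn.mono (IsPrimitive.sum hTk m) (Set.subset_univ _)).congr_nhds ?_
      rintro t ⟨V, hV, hVd⟩
      refine ⟨V, hV, fun u v hu hv hs => ?_⟩
      have htV : t ∉ ⋃ k ≥ m, Set.Icc (c k) (d k) := by
        simp only [Set.mem_iUnion, not_exists]
        exact fun k hk h => Set.disjoint_left.1 (hVd k hk) (mem_of_mem_nhds hV) h
      have h1 : (∑' k, T k v) - ∑' k, T k u =
          (∑ k ∈ Finset.range m, T k v) - ∑ k ∈ Finset.range m, T k u := by
        rw [← (hTs v).sum_add_tsum_nat_add m, ← (hTs u).sum_add_tsum_nat_add m]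
        -- An interval disjoint from `[u, v]` lies on one side of it, so both points clamp to the
        -- same end.
        have : ∀ k, T (k + m) v = T (k + m) u := by
          intro k
          have hdis := (hVd (k + m) (by omega)).mono_left hs
          rw [Set.disjoint_left] at hdis
          rcases lt_or_ge v (c (k + m)) with h | h
          · simp only [hT]
            rw [clamp_of_le h.le, clamp_of_le ((hu.trans hv).trans h.le)]
          · rcases lt_or_ge (d (k + m)) u with h' | h'
            · simp only [hT]
              rw [clamp_of_ge (hcd _) h'.le, clamp_of_ge (hcd _) (h'.le.trans (hu.trans hv))]
            · exact absurd ⟨le_max_right u _, max_le h' (hcd _)⟩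
                (hdis ⟨le_max_left _ _, max_le (hu.trans hv) h⟩)
        simp only [this]
        ring
      have h2 : φ t * ∑' k, (Set.Ioo (c k) (d k)).indicator 1 t =
          ∑ k ∈ Finset.range m, (Set.Ioo (c k) (d k)).indicator φ t := by
        rw [tsum_eq_sum (s := Finset.range m), Finset.mul_sum]
        · refine Finset.sum_congr rfl fun k _ => ?_
          by_cases h : t ∈ Set.Ioo (c k) (d k) <;> simp [h]
        · intro k hk
          refine Set.indicator_of_notMem (fun h => htV ?_) _
          simp only [Set.mem_iUnion]
          exact ⟨k, by simpa using hk, Set.Ioo_subset_Icc_self h⟩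
      rw [density, density, h1, h2]
  · by_cases htx : t = x
    · exact ⟨0, htx⟩
    obtain ⟨V, V', hVo, hVo', htV, hxV', hdis⟩ := t2_separation htx
    have h1 : ∀ᶠ k in atTop, Set.Icc (c k) (d k) ⊆ V' :=
      (hc.Icc hd).eventually (eventually_smallSets_subset.2 (hVo'.mem_nhds hxV'))
    obtain ⟨m, hm⟩ := eventually_atTop.1 h1
    exact ⟨m + 1, V, hVo.mem_nhds htV, fun k hk => hdis.mono_right (hm k hk)⟩

/-! ### The gliding hump -/

theorem bounded_of_continuous {F : EReal → ℝ} (hF : Continuous F) (x : EReal) :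
    ∃ C, ∀ y, |F y - F x| ≤ C := by
  obtain ⟨C, hC⟩ := isCompact_univ.exists_bound_of_continuousOn
    (f := fun y => F y - F x) (hF.sub continuous_const).continuousOn
  exact ⟨C, fun y => hC y (Set.mem_univ y)⟩

/-- A sequence of continuous functions on the extended real line whose increments tend to zero
pointwise but not uniformly has large increments towards a single point. -/
theorem exists_frequently_of_not_uniform {G : ℕ → EReal → ℝ}
    (hp : ∀ c d, Tendsto (fun n => G n d - G n c) atTop (𝓝 0)) {δ : ℝ} (hδ : 0 < δ)
    (hf : ∃ᶠ n in atTop, ∃ c d, δ < |G n d - G n c|) :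
    ∃ (θ : ℕ → ℕ) (x : ℕ → EReal) (x₀ : EReal), StrictMono θ ∧ Tendsto x atTop (𝓝 x₀) ∧
      ∃ᶠ k in atTop, δ / 3 ≤ |G (θ k) (x k) - G (θ k) x₀| := by
  obtain ⟨θ, hθ, hG⟩ := extraction_of_frequently_atTop hf
  choose c d hcd using hG
  obtain ⟨⟨c₀, d₀⟩, -, ψ, hψ, hlim⟩ := isCompact_univ.tendsto_subseq
    (x := fun k => (c k, d k)) fun k => Set.mem_univ _
  have hc : Tendsto (fun k => c (ψ k)) atTop (𝓝 c₀) :=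
    (continuous_fst.tendsto _).comp hlim
  have hd : Tendsto (fun k => d (ψ k)) atTop (𝓝 d₀) :=
    (continuous_snd.tendsto _).comp hlim
  have h0 : ∀ᶠ k in atTop, |G (θ (ψ k)) d₀ - G (θ (ψ k)) c₀| < δ / 3 := by
    have := ((hp c₀ d₀).comp ((hθ.comp hψ).tendsto_atTop)).eventually
      (Metric.ball_mem_nhds 0 (show 0 < δ / 3 by positivity))
    simpa using this
  -- The increment over `[c₀, d₀]` is eventually below `δ / 3`, so one of the two end points must
  -- account for another third of `δ`.
  have hor : ∀ᶠ k in atTop, δ / 3 ≤ |G (θ (ψ k)) (c (ψ k)) - G (θ (ψ k)) c₀| ∨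
      δ / 3 ≤ |G (θ (ψ k)) (d (ψ k)) - G (θ (ψ k)) d₀| := by
    filter_upwards [h0] with k hk
    by_contra! hcon
    have h1 := hcd (ψ k)
    have h2 := abs_lt.1 hcon.1
    have h3 := abs_lt.1 hcon.2
    have h4 := abs_lt.1 hk
    refine absurd h1 (not_lt.2 (abs_le.2 ⟨?_, ?_⟩)) <;> linarith
  rcases frequently_or_distrib.1 hor.frequently with h | h
  · exact ⟨θ ∘ ψ, _, c₀, hθ.comp hψ, hc, h⟩
  · exact ⟨θ ∘ ψ, _, d₀, hθ.comp hψ, hd, h⟩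

/-- The selection of a gliding hump. -/
theorem exists_gliding_hump {F : EReal → ℝ} {G : ℕ → EReal → ℝ} (hF : Continuous F)
    (hG : ∀ n, Continuous (G n)) (hp : ∀ c d, Tendsto (fun n => G n d - G n c) atTop (𝓝 0))
    {δ : ℝ} (hδ : 0 < δ) {x : ℕ → EReal} {x₀ : EReal} (hx : Tendsto x atTop (𝓝 x₀))
    (hf : ∃ᶠ k in atTop, δ ≤ |G k (x k) - G k x₀|) :
    ∃ ν : ℕ → ℕ, StrictMono ν ∧
      (∀ k, δ ≤ |G (ν k) (x (ν k)) - G (ν k) x₀|) ∧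
      (∀ k, ∀ y ∈ Set.uIcc (x (ν k)) x₀, |F y - F x₀| ≤ (1 / 2) ^ k) ∧
      (∀ j k, j < k → ∀ y ∈ Set.uIcc (x (ν k)) x₀,
        |G (ν j) y - G (ν j) x₀| ≤ δ / 8 * (1 / 2) ^ k) ∧
      (∀ j k, j < k → |G (ν k) (x (ν j)) - G (ν k) x₀| ≤ δ / 8 * (1 / 2) ^ j) := by
  have hosc : ∀ {H : EReal → ℝ}, Continuous H → ∀ ε > 0, ∀ᶠ n in atTop,
      ∀ y ∈ Set.uIcc (x n) x₀, |H y - H x₀| ≤ ε := by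
    intro H hH ε hε
    have h1 : {y | |H y - H x₀| ≤ ε} ∈ 𝓝 x₀ := by
      have := (hH.tendsto x₀).eventually (Metric.closedBall_mem_nhds _ hε)
      filter_upwards [this] with y hy
      rwa [Real.dist_eq] at hy
    exact (hx.uIcc tendsto_const_nhds).eventually (eventually_smallSets_subset.2 h1)
  -- A pair is an index together with a level that fixes its tolerance. The recursion does not see
  -- its position, but levels increase strictly, so the `k`-th is at least `k`.
  obtain ⟨σ, hσ, hσr⟩ := exists_seq_of_forall_finset_exists (α := ℕ × ℕ)
    (fun p => δ ≤ |G p.1 (x p.1) - G p.1 x₀| ∧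
      ∀ y ∈ Set.uIcc (x p.1) x₀, |F y - F x₀| ≤ (1 / 2) ^ p.2)
    (fun p q => p.1 < q.1 ∧ p.2 < q.2 ∧
      (∀ y ∈ Set.uIcc (x q.1) x₀, |G p.1 y - G p.1 x₀| ≤ δ / 8 * (1 / 2) ^ q.2) ∧
      |G q.1 (x p.1) - G q.1 x₀| ≤ δ / 8 * (1 / 2) ^ p.2) (by
    intro s _
    set l := s.sup Prod.snd + 1 with hl
    have hε : ∀ m : ℕ, 0 < δ / 8 * (1 / 2) ^ m := fun m => by positivity
    have e1 := hosc hF ((1 / 2) ^ l) (by positivity)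
    have e2 : ∀ᶠ n in atTop, ∀ p ∈ s, p.1 < n ∧
        (∀ y ∈ Set.uIcc (x n) x₀, |G p.1 y - G p.1 x₀| ≤ δ / 8 * (1 / 2) ^ l) ∧
        |G n (x p.1) - G n x₀| ≤ δ / 8 * (1 / 2) ^ p.2 := by
      refine (Finset.eventually_all s).2 fun p _ => ?_
      refine (eventually_gt_atTop p.1).and ((hosc (hG p.1) _ (hε l)).and ?_)
      have := (hp x₀ (x p.1)).eventually (Metric.closedBall_mem_nhds _ (hε p.2))
      simpa using this
    obtain ⟨n, hn, hn1, hn2⟩ := (hf.and_eventually (e1.and e2)).exists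
    exact ⟨(n, l), ⟨hn, hn1⟩, fun p hps => ⟨(hn2 p hps).1,
      Nat.lt_succ_of_le (Finset.le_sup (f := Prod.snd) hps), (hn2 p hps).2⟩⟩)
  have hlev : ∀ k, k ≤ (σ k).2 := fun k =>
    StrictMono.le_apply (f := fun k => (σ k).2) fun j k hjk => (hσr j k hjk).2.1
  have hpow : ∀ k, ((1 : ℝ) / 2) ^ (σ k).2 ≤ (1 / 2) ^ k := fun k =>
    pow_le_pow_of_le_one (by norm_num) (by norm_num) (hlev k)
  refine ⟨fun k => (σ k).1, fun j k hjk => (hσr j k hjk).1, fun k => (hσ k).1,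
    fun k y hy => ((hσ k).2 y hy).trans (hpow k), fun j k hjk y hy => ?_, fun j k hjk => ?_⟩
  · exact ((hσr j k hjk).2.2.1 y hy).trans (mul_le_mul_of_nonneg_left (hpow k) (by positivity))
  · exact ((hσr j k hjk).2.2.2).trans (mul_le_mul_of_nonneg_left (hpow j) (by positivity))

/-- The off-diagonal terms add up to at most `δ / 4`. -/
theorem abs_tsum_ge {s : ℕ → ℝ} (hs : Summable s) {δ : ℝ} (hδ : 0 < δ) (k : ℕ)
    (hk : δ ≤ |s k|) (hj : ∀ j, j ≠ k → |s j| ≤ δ / 8 * (1 / 2) ^ j) : δ / 2 ≤ |∑' j, s j| := by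
  have hg : Summable fun j : ℕ => δ / 8 * (1 / 2 : ℝ) ^ j :=
    summable_geometric_two.mul_left _
  have h1 := hs.tsum_eq_add_tsum_ite k
  have h2 : ‖∑' j, if j = k then 0 else s j‖ ≤ ∑' j : ℕ, δ / 8 * (1 / 2 : ℝ) ^ j := by
    refine tsum_of_norm_bounded hg.hasSum fun j => ?_
    split_ifs with h
    · simpa using by positivity
    · exact hj j h
  rw [tsum_mul_left, tsum_geometric_two, Real.norm_eq_abs] at h2
  rw [h1]
  have h3 := abs_sub_abs_le_abs_sub (s k) (-∑' j, if j = k then 0 else s j)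
  rw [sub_neg_eq_add, abs_neg] at h3
  linarith

/-! ### Alexiewicz norm, uniform increments and the equivalence -/

theorem tendsto_alexiewiczNorm_of_increments {h : ℕ → ℝ → ℝ} {a b : EReal} {G : ℕ → EReal → ℝ}
    (hG : ∀ n, IsPrimitive (extendZero (h n) a b) (G n))
    (hu : ∀ δ > 0, ∀ᶠ n in atTop, ∀ c d, |G n d - G n c| ≤ δ) :
    Tendsto (fun n => alexiewiczNorm (h n) a b) atTop (𝓝 0) := by
  refine ENNReal.tendsto_nhds_zero.2 fun ε hε => ?_
  by_cases ht : ε = ⊤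
  · simp [ht]
  filter_upwards [hu ε.toReal (ENNReal.toReal_pos hε.ne' ht)] with n hn
  refine iSup_le fun c => iSup_le fun d => iSup_le fun hcd => ?_
  rw [(hG n).integral_Ioo hcd.1 hcd.2.1 hcd.2.2]
  exact ENNReal.ofReal_le_of_le_toReal (hn c d)

theorem ofReal_abs_integral_le_alexiewiczNorm {h : ℝ → ℝ} {a b : EReal} (hab : a ≤ b) :
    ENNReal.ofReal |integral h a b| ≤ alexiewiczNorm h a b :=
  le_iSup_of_le a (le_iSup_of_le b (le_iSup_of_le ⟨le_rfl, hab, le_rfl⟩ le_rfl))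

theorem tendsto_integral_of_tendsto_alexiewiczNorm {f : ℕ → ℝ → ℝ} {g : ℝ → ℝ} {a b : EReal}
    (hab : a ≤ b) (hf : ∀ n, Integrable (f n) a b) (hg : Integrable g a b)
    (h : Tendsto (fun n => alexiewiczNorm (fun x => f n x - g x) a b) atTop (𝓝 0)) :
    Tendsto (fun n => integral (f n) a b) atTop (𝓝 (integral g a b)) := by
  refine tendsto_iff_dist_tendsto_zero.2 ?_
  have h1 : Tendsto (fun n => ENNReal.ofReal |integral (fun x => f n x - g x) a b|) atTop (𝓝 0) :=
    tendsto_of_tendsto_of_tendsto_of_le_of_le tendsto_const_nhds h (fun _ => zero_le)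
      fun n => ofReal_abs_integral_le_alexiewiczNorm hab
  have h2 := (ENNReal.tendsto_toReal ENNReal.zero_ne_top).comp h1
  refine h2.congr fun n => ?_
  simp only [Function.comp]
  rw [ENNReal.toReal_ofReal (abs_nonneg _), ((hf n).sub hab hg).2, Real.dist_eq]

/-- A multiplier sequence with convergent integrals has uniformly small increments. -/
theorem eventually_increments_le {a b : EReal} (hab : a ≤ b) {h : ℕ → ℝ → ℝ}
    (hh : ∀ f, Integrable f a b →
      Tendsto (fun n => integral (fun x => f x * h n x) a b) atTop (𝓝 0))
    {f : ℝ → ℝ} (hf : Integrable f a b) {G : ℕ → EReal → ℝ}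
    (hG : ∀ n, IsPrimitive (extendZero (fun x => f x * h n x) a b) (G n)) {δ : ℝ} (hδ : 0 < δ) :
    ∀ᶠ n in atTop, ∀ c d, |G n d - G n c| ≤ δ := by
  obtain ⟨F, hF⟩ := hf.exists_isPrimitive hab
  have hFc := hF.continuous (extendZero_bot _ _ _) (extendZero_top _ _ _)
  have hGc : ∀ n, Continuous (G n) := fun n =>
    (hG n).continuous (extendZero_bot _ _ _) (extendZero_top _ _ _)
  have hmul : ∀ (W : EReal → ℝ) (n : ℕ), extendZero (fun x => f x * W x * h n x) a b =
      fun t => extendZero (fun x => f x * h n x) a b t * W t := by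
    intro W n
    rw [← extendZero_mul]
    congr 1
    funext x
    ring
  have hp' : ∀ c d, c ≤ d → Tendsto (fun n => G n d - G n c) atTop (𝓝 0) := by
    intro c d hcd
    have hind : ∀ φ : EReal → ℝ, (fun t => φ t * (Set.Ioo c d).indicator 1 t) =
        (Set.Ioo c d).indicator φ := by
      intro φ
      funext t
      by_cases ht : t ∈ Set.Ioo c d <;> simp [ht]
    have h1 := hF.indicator_Ioo (extendZero_bot _ _ _) (extendZero_top _ _ _) hcd
    rw [← hind, ← extendZero_mul] at h1
    refine (hh _ h1.hasIntegral.integrable).congr fun n => ?_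
    have h2 := (hG n).indicator_Ioo (extendZero_bot _ _ _) (extendZero_top _ _ _) hcd
    rw [← hind, ← hmul] at h2
    rw [h2.integral_eq hab, clamp_of_ge hcd le_top, clamp_of_le bot_le]
  have hp : ∀ c d, Tendsto (fun n => G n d - G n c) atTop (𝓝 0) := by
    intro c d
    rcases le_total c d with hcd | hcd
    · exact hp' c d hcd
    · simpa using (hp' d c hcd).neg
  by_contra hcon
  have hfr : ∃ᶠ n in atTop, ∃ c d, δ < |G n d - G n c| := by
    rw [not_eventually] at hcon
    simpa using hcon
  obtain ⟨θ, x, x₀, hθ, hx, hfr⟩ := exists_frequently_of_not_uniform hp hδ hfr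
  obtain ⟨ν, hν, hdiag, hFs, hlater, hearlier⟩ := exists_gliding_hump hFc (fun k => hGc (θ k))
    (fun c d => (hp c d).comp hθ.tendsto_atTop) (by positivity : 0 < δ / 3) hx hfr
  -- The point `x (ν k)` may lie on either side of `x₀`; the order only affects the sign of
  -- increments.
  set c : ℕ → EReal := fun k => min (x (ν k)) x₀ with hc
  set d : ℕ → EReal := fun k => max (x (ν k)) x₀ with hd
  have hcd : ∀ k, c k ≤ d k := fun k => min_le_max
  have hxν := hx.comp hν.tendsto_atTop
  have hcl : Tendsto c atTop (𝓝 x₀) := by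
    simpa using hxν.min (tendsto_const_nhds (x := x₀))
  have hdl : Tendsto d atTop (𝓝 x₀) := by
    simpa using hxν.max (tendsto_const_nhds (x := x₀))
  have hcI : ∀ k, c k ∈ Set.uIcc (x (ν k)) x₀ := fun k => ⟨le_rfl, hcd k⟩
  have hinc : ∀ (H : EReal → ℝ) k, |H (d k) - H (c k)| = |H (x (ν k)) - H x₀| := by
    intro H k
    rcases le_total (x (ν k)) x₀ with h | h
    · simp only [hc, hd, min_eq_left h, max_eq_right h, abs_sub_comm]
    · simp only [hc, hd, min_eq_right h, max_eq_left h]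
  have hdouble : ∀ {H : EReal → ℝ} {k : ℕ} {β : ℝ},
      (∀ y ∈ Set.uIcc (x (ν k)) x₀, |H y - H x₀| ≤ β) →
      ∀ y ∈ Set.Icc (c k) (d k), |H y - H (c k)| ≤ 2 * β := by
    intro H k β hβ y hy
    have h1 := abs_le.1 (hβ y hy)
    have h2 := abs_le.1 (hβ (c k) (hcI k))
    rw [abs_le]
    constructor <;> linarith
  have hgeo : ∀ C : ℝ, Summable fun k : ℕ => 2 * (C * (1 / 2 : ℝ) ^ k) := fun C =>
    (summable_geometric_two.mul_left C).mul_left 2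
  have hf' := hF.tsum_indicator (extendZero_bot _ _ _) (extendZero_top _ _ _) hcd hcl hdl
    (hgeo 1) fun k => hdouble (by simpa using hFs k)
  rw [← extendZero_mul] at hf'
  have hlim := ((hh _ hf'.hasIntegral.integrable).comp hθ.tendsto_atTop).comp hν.tendsto_atTop
  have hlow : ∀ k, δ / 3 / 2 ≤ |integral (fun x => f x *
      (∑' k, (Set.Ioo (c k) (d k)).indicator 1 (x : EReal)) * h (θ (ν k)) x) a b| := by
    intro k
    obtain ⟨C, hC⟩ := bounded_of_continuous (hGc (θ (ν k))) x₀
    have hC0 : 0 ≤ C := (abs_nonneg _).trans (hC x₀)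
    -- A crude bound, needed only for summability: the factor `2 ^ k` absorbs the finitely many `j ≤
    -- k`, where only boundedness of `G` is available.
    have hB : ∀ j, ∀ y ∈ Set.uIcc (x (ν j)) x₀, |G (θ (ν k)) y - G (θ (ν k)) x₀| ≤
        (C * 2 ^ k + δ / 3 / 8) * (1 / 2) ^ j := by
      intro j y hy
      have hj : (0 : ℝ) < (1 / 2) ^ j := by positivity
      rcases lt_or_ge k j with hkj | hkj
      · refine (hlater k j hkj y hy).trans (mul_le_mul_of_nonneg_right ?_ hj.le)
        have : 0 ≤ C * 2 ^ k := by positivity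
        linarith
      · have h1 : C ≤ C * 2 ^ k * (1 / 2) ^ j := by
          rw [mul_assoc]
          refine le_mul_of_one_le_right hC0 ?_
          have h2 : (2 : ℝ) ^ j ≤ 2 ^ k := pow_le_pow_right₀ (by norm_num) hkj
          calc (1 : ℝ) = 2 ^ j * (1 / 2) ^ j := by rw [← mul_pow]; norm_num
            _ ≤ _ := mul_le_mul_of_nonneg_right h2 hj.le
        refine (hC y).trans (h1.trans (mul_le_mul_of_nonneg_right ?_ hj.le))
        linarith
    have hS := (hG (θ (ν k))).tsum_indicator (extendZero_bot _ _ _) (extendZero_top _ _ _) hcd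
      hcl hdl (hgeo _) fun j => hdouble (hB j)
    rw [← hmul] at hS
    rw [hS.integral_eq hab]
    have e1 : ∀ j, clamp (c j) (d j) ⊤ = d j := fun j => clamp_of_ge (hcd j) le_top
    have e2 : ∀ j, clamp (c j) (d j) ⊥ = c j := fun j => clamp_of_le bot_le
    simp only [e1, e2, sub_self, tsum_zero, sub_zero]
    -- The integral is the `k`-th row sum of the increment matrix; `hdiag` bounds the diagonal entry
    -- from below, `hearlier` and `hlater` the others from above.
    refine abs_tsum_ge ?_ (by positivity) k ?_ fun j hj => ?_
    · exact (hgeo _).of_norm_bounded fun j =>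
        hdouble (hB j) _ (Set.right_mem_Icc.2 (hcd j))
    · rw [hinc]
      exact hdiag k
    · rw [hinc]
      rcases lt_or_gt_of_ne hj with h | h
      · exact hearlier j k h
      · exact hlater k j h _ Set.left_mem_uIcc
  have := ge_of_tendsto' hlim.abs hlow
  rw [abs_zero] at this
  linarith

end HenstockKurzweil

theorem theorem4 (a b : EReal) (hab : a < b) (gn : ℕ → ℝ → ℝ) (g : ℝ → ℝ) :
    (∀ f : ℝ → ℝ, HenstockKurzweil.Integrable f a b →
      (∀ n, HenstockKurzweil.Integrable (fun x => f x * gn n x) a b) ∧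
      HenstockKurzweil.Integrable (fun x => f x * g x) a b ∧
      Tendsto (fun n => HenstockKurzweil.integral (fun x => f x * gn n x) a b) atTop
        (𝓝 (HenstockKurzweil.integral (fun x => f x * g x) a b))) ↔
    (∀ f : ℝ → ℝ, HenstockKurzweil.Integrable f a b →
      (∀ n, HenstockKurzweil.Integrable (fun x => f x * gn n x) a b) ∧
      HenstockKurzweil.Integrable (fun x => f x * g x) a b ∧
      Tendsto (fun n => HenstockKurzweil.alexiewiczNorm
        (fun x => f x * gn n x - f x * g x) a b) atTop (𝓝 0)) := by
  refine ⟨fun H f hf => ⟨(H f hf).1, (H f hf).2.1, ?_⟩, fun H f hf => ⟨(H f hf).1, (H f hf).2.1,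
    HenstockKurzweil.tendsto_integral_of_tendsto_alexiewiczNorm hab.le (H f hf).1 (H f hf).2.1
      (H f hf).2.2⟩⟩
  -- By linearity the limit function may be taken to be 0.
  have hh : ∀ f, HenstockKurzweil.Integrable f a b → Tendsto (fun n =>
      HenstockKurzweil.integral (fun x => f x * (gn n x - g x)) a b) atTop (𝓝 0) := by
    intro f hf
    obtain ⟨h1, h2, h3⟩ := H f hf
    have h4 := h3.sub_const (HenstockKurzweil.integral (fun x => f x * g x) a b)
    rw [sub_self] at h4
    refine h4.congr fun n => ?_
    rw [← ((h1 n).sub hab.le h2).2]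
    simp only [mul_sub]
  have hprim : ∀ n, ∃ G, HenstockKurzweil.IsPrimitive
      (HenstockKurzweil.extendZero (fun x => f x * (gn n x - g x)) a b) G := by
    intro n
    simp only [mul_sub]
    exact (((H f hf).1 n).sub hab.le (H f hf).2.1).1.exists_isPrimitive hab.le
  choose G hG using hprim
  have := HenstockKurzweil.tendsto_alexiewiczNorm_of_increments hG fun δ hδ =>
    HenstockKurzweil.eventually_increments_le hab.le hh hf hG hδ
  simpa only [mul_sub] using this
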